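/- Let $c_0$ be the Banach space of scalar sequences converging to $0$ with the sup norm, over $\mathbb K=\mathbb R$ or $\mathbb C$, let $(e_j)_{j\ge1}$ be its canonical unit vectors, and for a continuous $m$-linear form $T\colon c_0\times\cdots\times c_0\to\mathbb K$ put $\|T\|=\sup\{|T(x^{(1)},\dots,x^{(m)})| : \|x^{(j)}\|=1,\ 1\le j\le m\}$. For every positive integer $M$ there is a constant $\eta_M\ge1$, depending only on $M$, such that for every integer $m\ge M$, for $\mathbb K=\mathbb R$ and for $\mathbb K=\mathbb C$, $$\Bigl(\sum_{\operatorname{card}\{i_1,\dots,i_m\}\le M}|T(e_{i_1},\dots,e_{i_m})|^{\frac{2m}{m+1}}\Bigr)^{\frac{m+1}{2m}}\le\eta_M\|T\|\qquad(*)$$ for all continuous $m$-linear forms $T\colon c_0\times\cdots\times c_0\to\mathbb K$, where the sum runs over all $(i_1,\dots,i_m)\in\mathbb N^m$ having at most $M$ distinct entries. Moreover, let $\overline C^{\,\mathbb R}_{m,M}$ denote, for given $m\ge M$, the optimal constant in $(*)$ for real scalars, that is, the infimum of all $C$ such that $(*)$ with $C$ in place of $\eta_M$ holds for all continuous real $m$-linear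 forms $T$. Then $$2\le\liminf_{m\to\infty}\overline C^{\,\mathbb R}_{m,M}\le\limsup_{m\to\infty}\overline C^{\,\mathbb R}_{m,M}\le M^{\frac{M+1}{2}}\quad\text{if }M\ge3,$$ $$\sqrt2\le\liminf_{m\to\infty}\overline C^{\,\mathbb R}_{m,M}\le\limsup_{m\to\infty}\overline C^{\,\mathbb R}_{m,M}\le\sqrt8\quad\text{if }M=2.$$ -/

import Mathlib

open Filter Topology
open scoped ENNReal ZeroAtInfty

noncomputable section

namespace BohnenblustHille

/-- The canonical unit vector `e_j` of `c₀`, the space of scalar sequences tending to zero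
with the sup norm. Here `c₀` is `C₀(ℕ, 𝕜)`, sequences being indexed from zero. -/
def unitVec (𝕜 : Type*) [RCLike 𝕜] (j : ℕ) : C₀(ℕ, 𝕜) where
  toFun := Pi.single j 1
  continuous_toFun := continuous_of_discreteTopology
  zero_at_infty' := by
    rw [cocompact_eq_cofinite]
    refine tendsto_const_nhds.congr' ?_
    filter_upwards [(Set.finite_singleton j).compl_mem_cofinite] with i hi
    exact (Pi.single_eq_of_ne (M := fun _ : ℕ => 𝕜) (by simpa using hi) _).symm

/-- Continuous `m`-linear forms `c₀ × ⋯ × c₀ → 𝕜`, with the operator norm. -/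
abbrev Form (𝕜 : Type*) [RCLike 𝕜] (m : ℕ) : Type _ :=
  ContinuousMultilinearMap 𝕜 (fun _ : Fin m => C₀(ℕ, 𝕜)) 𝕜

/-- The (possibly infinite) quantity
`(∑ |T(e_{i₁}, …, e_{iₘ})| ^ (2m/(m+1))) ^ ((m+1)/(2m))`, the sum being over all
`(i₁, …, iₘ)` with `card {i₁, …, iₘ} ≤ M`. -/
def restrictedSum {𝕜 : Type*} [RCLike 𝕜] {m : ℕ} (M : ℕ) (T : Form 𝕜 m) : ℝ≥0∞ :=
  (∑' i : {i : Fin m → ℕ // (Set.range i).ncard ≤ M},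
    ‖T (fun k => unitVec 𝕜 (i.1 k))‖ₑ ^ (2 * (m : ℝ) / ((m : ℝ) + 1))) ^
      (((m : ℝ) + 1) / (2 * (m : ℝ)))

/-- The optimal (that is, least) constant `C` in `restrictedSum M T ≤ C ‖T‖`, for all
continuous `m`-linear forms `T`, as an extended nonnegative real (`∞` if there is no finite
constant). -/
def optimalConst (𝕜 : Type*) [RCLike 𝕜] (m M : ℕ) : ℝ≥0∞ :=
  sInf {C : ℝ≥0∞ | ∀ T : Form 𝕜 m, restrictedSum M T ≤ C * ‖T‖ₑ}

end BohnenblustHille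

end

/-!
The upper bound interpolates the exponent `p = 2m/(m+1)` between two exponents at which the number
of variables is harmless.

* At exponent `2`, orthogonality of the products of Rademacher functions shows that
  `∑ |T(e_i)|² ≤ ‖T‖²` over all indices (`SignBounded.sum_sq_le`).
* At exponent `q = 2M/(M+1)`, every index with at most `M ≤ m` distinct entries has the form `j ∘ f`
  with `f` a surjection onto `M` elements. For fixed `f` the array `j ↦ T(e_{j ∘ f})` defines an
  `M`-linear form, which on sign vectors is still bounded by `‖T‖`: this follows by averaging over
  auxiliary signs (`SignBounded.comp_surjective`). The Bohnenblust–Hille inequality for `M`-linear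
  forms (`SignBounded.sum_rpow_le`), with the constant `B = 2 ^ (M+1)`, and the count of at most
  `M ^ m` surjections give `∑ |T(e_i)| ^ q ≤ M ^ m * (B * ‖T‖) ^ q`.

Since `p = θ q + (1 - θ) 2` with the small weight `θ = (M+1)/(m+1)`, the factor `M ^ m`
contributes exactly `M ^ ((M+1)/2)` and `B` contributes `B ^ (M/m)`, which is bounded and tends to
one (`SignBounded.sum_rpow_few_le`, `restrictedSum_le`).

The Bohnenblust–Hille inequality itself is proved from Khinchine's inequality for decoupled
Rademacher chaoses (`sqrt_sum_sq_le_sum_signs_chaos`) and Blei's interpolation of mixed `ℓ¹(ℓ²)`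
norms (`sum_rpow_le_of_mixed_sum_le`).

For the lower bounds, the forms `∑_c y_c * ∏ l, (x l 0 ± x l 1)`, with signs given by
`c ∈ {0,1} ^ h` and with `y_c` a product of coordinates of the remaining variables, have norm at
most `2 ^ h` and `4 ^ h` coefficients of modulus one, so that the optimal constant is at least
`2 ^ (h/m)` (`two_rpow_le_optimalConst`). If three distinct entries are allowed, a single variable
can encode all of `c`, so that `h = m - 1`; with two entries, `c` takes up as many variables as the
`x l`, and `h = m / 2` rounded down.
-/

namespace BohnenblustHille

/-! ### Khinchine's inequality and orthogonality of Rademacher chaoses -/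

section Khinchine

lemma sum_fin_succ_pi {α β : Type*} [Fintype α] [AddCommMonoid β] {n : ℕ}
    (F : (Fin (n + 1) → α) → β) :
    ∑ x, F x = ∑ a, ∑ y : Fin n → α, F (Fin.cons a y) := by
  rw [← (Fin.consEquiv (fun _ => α)).sum_comp, Fintype.sum_prod_type]
  rfl

lemma sum_intUnits {β : Type*} [AddCommMonoid β] (F : ℤˣ → β) : ∑ u, F u = F 1 + F (-1) := by
  rw [UnitsInt.univ, Finset.sum_pair (by decide)]

lemma sum_signs_norm_sq (𝕜 : Type*) [RCLike 𝕜] {H : Type*} [NormedAddCommGroup H]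
    [InnerProductSpace 𝕜 H] {n : ℕ} (b : Fin n → H) :
    ∑ ε : Fin n → ℤˣ, ‖∑ j, ε j • b j‖ ^ 2 = 2 ^ n * ∑ j, ‖b j‖ ^ 2 := by
  induction n with
  | zero => simp
  | succ n ih =>
    rw [sum_fin_succ_pi, Finset.sum_comm]
    simp only [Fin.sum_univ_succ, Fin.cons_zero, Fin.cons_succ, sum_intUnits, one_smul,
      Units.neg_smul]
    have key (S : H) : ‖b 0 + S‖ ^ 2 + ‖-b 0 + S‖ ^ 2 = 2 * ‖b 0‖ ^ 2 + 2 * ‖S‖ ^ 2 := by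
      have := parallelogram_law_with_norm 𝕜 S (b 0)
      rw [show b 0 + S = S + b 0 by abel, show -b 0 + S = S - b 0 by abel]
      linarith
    simp only [key, Finset.sum_add_distrib, ← Finset.mul_sum, ih]
    simp [Fintype.card_pi]
    ring

lemma sum_signs_norm_pow_four_le (𝕜 : Type*) [RCLike 𝕜] {H : Type*} [NormedAddCommGroup H]
    [InnerProductSpace 𝕜 H] {n : ℕ} (b : Fin n → H) :
    ∑ ε : Fin n → ℤˣ, ‖∑ j, ε j • b j‖ ^ 4 ≤ 3 * 2 ^ n * (∑ j, ‖b j‖ ^ 2) ^ 2 := by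
  induction n with
  | zero => simp
  | succ n ih =>
    rw [sum_fin_succ_pi, Finset.sum_comm]
    simp only [Fin.sum_univ_succ, Fin.cons_zero, Fin.cons_succ, sum_intUnits, one_smul,
      Units.neg_smul]
    have key (S : H) : ‖b 0 + S‖ ^ 4 + ‖-b 0 + S‖ ^ 4 ≤
        2 * ‖b 0‖ ^ 4 + 12 * ‖b 0‖ ^ 2 * ‖S‖ ^ 2 + 2 * ‖S‖ ^ 4 := by
      have h1 := norm_add_sq (𝕜 := 𝕜) S (b 0)
      have h2 := norm_sub_sq (𝕜 := 𝕜) S (b 0)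
      rw [show b 0 + S = S + b 0 by abel, show -b 0 + S = S - b 0 by abel]
      have h3 : RCLike.re (inner 𝕜 S (b 0)) ^ 2 ≤ (‖S‖ * ‖b 0‖) ^ 2 :=
        sq_le_sq' (by linarith [neg_abs_le (RCLike.re (inner 𝕜 S (b 0))),
          (RCLike.abs_re_le_norm (inner 𝕜 S (b 0))).trans (norm_inner_le_norm S (b 0))])
          ((le_abs_self _).trans
            ((RCLike.abs_re_le_norm _).trans (norm_inner_le_norm _ _)))
      generalize RCLike.re (inner 𝕜 S (b 0)) = r at h1 h2 h3
      have h4 : ‖S + b 0‖ ^ 4 + ‖S - b 0‖ ^ 4 =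
          (‖S‖ ^ 2 + 2 * r + ‖b 0‖ ^ 2) ^ 2 + (‖S‖ ^ 2 - 2 * r + ‖b 0‖ ^ 2) ^ 2 := by
        rw [← h1, ← h2]; ring
      rw [h4]
      linarith
    refine (Finset.sum_le_sum fun ε _ => key _).trans ?_
    have h := ih fun j => b j.succ
    simp only [Finset.sum_add_distrib, ← Finset.mul_sum, sum_signs_norm_sq 𝕜]
    simp only [Finset.sum_const, Finset.card_univ, Fintype.card_pi, Fintype.card_units_int,
      Finset.prod_const, Fintype.card_fin, nsmul_eq_mul, Nat.cast_pow, Nat.cast_ofNat]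
    set A := ∑ j : Fin n, ‖b j.succ‖ ^ 2
    rw [pow_succ (2 : ℝ) n]
    have : 0 ≤ (2 : ℝ) ^ n * (‖b 0‖ ^ 2) ^ 2 := by positivity
    nlinarith

/-- Khinchine's inequality in `L¹`, for Hilbert space valued Rademacher sums. It follows from the
second and fourth moments by averaging `t² ≤ t + (4/27) t⁴`. -/
lemma sqrt_sum_sq_le_sum_signs (𝕜 : Type*) [RCLike 𝕜] {H : Type*} [NormedAddCommGroup H]
    [InnerProductSpace 𝕜 H] {n : ℕ} (b : Fin n → H) :
    2 ^ n * √(∑ j, ‖b j‖ ^ 2) ≤ 2 * ∑ ε : Fin n → ℤˣ, ‖∑ j, ε j • b j‖ := by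
  have h2 := sum_signs_norm_sq 𝕜 b
  have h4 := sum_signs_norm_pow_four_le 𝕜 b
  set A := ∑ j, ‖b j‖ ^ 2 with hA
  have hA0 : 0 ≤ A := by positivity
  obtain ⟨σ, hσ, hσA⟩ : ∃ σ : ℝ, 0 ≤ σ ∧ A = σ ^ 2 := ⟨√A, by positivity, (Real.sq_sqrt hA0).symm⟩
  rw [hσA, Real.sqrt_sq hσ]
  rcases hσ.eq_or_lt with rfl | hpos
  · simp only [mul_zero]; positivity
  -- the homogeneous form of `t² ≤ t + (4/27) t⁴`, with equality at `t = 3/2`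
  have key (t : ℝ) (ht : 0 ≤ t) : σ ^ 2 * t ^ 2 ≤ σ ^ 3 * t + 4 / 27 * t ^ 4 := by
    have : 0 ≤ t * ((t - 3 / 2 * σ) ^ 2 * (t + 3 * σ)) := by positivity
    nlinarith
  have hsum := Finset.sum_le_sum fun (ε : Fin n → ℤˣ) (_ : ε ∈ Finset.univ) =>
    key ‖∑ j, ε j • b j‖ (norm_nonneg _)
  simp only [Finset.sum_add_distrib, ← Finset.mul_sum] at hsum
  rw [h2, hσA] at hsum
  rw [hσA] at h4
  set E := ∑ ε : Fin n → ℤˣ, ‖∑ j, ε j • b j‖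
  have h5 : σ ^ 3 * (2 ^ n * σ) ≤ σ ^ 3 * (2 * E) := by
    have : 0 ≤ (2 : ℝ) ^ n * σ ^ 4 := by positivity
    nlinarith
  exact le_of_mul_le_mul_left h5 (by positivity)

/-- Khinchine's inequality in `L¹` for decoupled Rademacher chaoses of order `k`. -/
lemma sqrt_sum_sq_le_sum_signs_chaos (𝕜 : Type*) [RCLike 𝕜] (k n : ℕ) {H : Type*}
    [NormedAddCommGroup H] [InnerProductSpace 𝕜 H] (b : (Fin k → Fin n) → H) :
    (2 ^ n) ^ k * √(∑ j, ‖b j‖ ^ 2) ≤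
      2 ^ k * ∑ ε : Fin k → Fin n → ℤˣ, ‖∑ j, (∏ s, ε s (j s)) • b j‖ := by
  induction k generalizing H with
  | zero => simp [Real.sqrt_sq (norm_nonneg _)]
  | succ k ih =>
    let B : (Fin k → Fin n) → PiLp 2 (fun _ : Fin n => H) :=
      fun y => WithLp.toLp 2 fun t => b (Fin.cons t y)
    have hB (y) : ‖B y‖ ^ 2 = ∑ t, ‖b (Fin.cons t y)‖ ^ 2 := by
      rw [PiLp.norm_sq_eq_of_L2]
    have h1 := ih B
    simp only [hB] at h1
    have hb : ∑ j, ‖b j‖ ^ 2 = ∑ y : Fin k → Fin n, ∑ t, ‖b (Fin.cons t y)‖ ^ 2 := by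
      rw [sum_fin_succ_pi, Finset.sum_comm]
    have hε : ∑ ε : Fin (k + 1) → Fin n → ℤˣ, ‖∑ j, (∏ s, ε s (j s)) • b j‖ =
        ∑ ε : Fin k → Fin n → ℤˣ, ∑ δ : Fin n → ℤˣ, ‖∑ j : Fin (k + 1) → Fin n,
          (∏ s, (Fin.cons δ ε : Fin (k + 1) → Fin n → ℤˣ) s (j s)) • b j‖ := by
      rw [sum_fin_succ_pi, Finset.sum_comm]
    rw [hb, hε]
    have h2 (ε : Fin k → Fin n → ℤˣ) : 2 ^ n * ‖∑ y, (∏ s, ε s (y s)) • B y‖ ≤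
        2 * ∑ δ : Fin n → ℤˣ, ‖∑ j : Fin (k + 1) → Fin n,
          (∏ s, (Fin.cons δ ε : Fin (k + 1) → Fin n → ℤˣ) s (j s)) • b j‖ := by
      have := sqrt_sum_sq_le_sum_signs 𝕜 (fun t => (∑ y, (∏ s, ε s (y s)) • B y) t)
      rw [← PiLp.norm_sq_eq_of_L2, Real.sqrt_sq (norm_nonneg _)] at this
      refine this.trans_eq ?_
      congr 1
      refine Finset.sum_congr rfl fun δ _ => ?_
      rw [sum_fin_succ_pi]
      congr 1
      refine Finset.sum_congr rfl fun t _ => ?_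
      simp [Fin.prod_univ_succ, mul_smul, Finset.smul_sum, B]
    calc _ = 2 ^ n * ((2 ^ n) ^ k * √(∑ y : Fin k → Fin n, ∑ t, ‖b (Fin.cons t y)‖ ^ 2)) := by
          ring
      _ ≤ 2 ^ n * (2 ^ k * ∑ ε : Fin k → Fin n → ℤˣ, ‖∑ y, (∏ s, ε s (y s)) • B y‖) := by
          gcongr
      _ = 2 ^ k * ∑ ε : Fin k → Fin n → ℤˣ, 2 ^ n * ‖∑ y, (∏ s, ε s (y s)) • B y‖ := by
          rw [← Finset.mul_sum]; ring
      _ ≤ 2 ^ k * ∑ ε : Fin k → Fin n → ℤˣ, 2 * ∑ δ : Fin n → ℤˣ,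
          ‖∑ j : Fin (k + 1) → Fin n,
          (∏ s, (Fin.cons δ ε : Fin (k + 1) → Fin n → ℤˣ) s (j s)) • b j‖ := by
          exact mul_le_mul_of_nonneg_left (Finset.sum_le_sum fun ε _ => h2 ε) (by positivity)
      _ = _ := by rw [← Finset.mul_sum]; ring

/-- Orthogonality of the products of Rademacher functions. -/
lemma sum_signs_chaos_norm_sq (𝕜 : Type*) [RCLike 𝕜] (k n : ℕ) {H : Type*}
    [NormedAddCommGroup H] [InnerProductSpace 𝕜 H] (b : (Fin k → Fin n) → H) :
    ∑ ε : Fin k → Fin n → ℤˣ, ‖∑ j, (∏ s, ε s (j s)) • b j‖ ^ 2 =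
      (2 ^ n) ^ k * ∑ j, ‖b j‖ ^ 2 := by
  induction k with
  | zero => simp
  | succ k ih =>
    rw [sum_fin_succ_pi, sum_fin_succ_pi, Finset.sum_comm]
    have h1 (ε : Fin k → Fin n → ℤˣ) : ∑ δ : Fin n → ℤˣ, ‖∑ j : Fin (k + 1) → Fin n,
        (∏ s, (Fin.cons δ ε : Fin (k + 1) → Fin n → ℤˣ) s (j s)) • b j‖ ^ 2 =
        2 ^ n * ∑ t, ‖∑ y : Fin k → Fin n, (∏ s, ε s (y s)) • b (Fin.cons t y)‖ ^ 2 := by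
      rw [← sum_signs_norm_sq 𝕜]
      refine Finset.sum_congr rfl fun δ _ => ?_
      rw [sum_fin_succ_pi]
      simp [Fin.prod_univ_succ, mul_smul, Finset.smul_sum]
    simp only [h1]
    rw [← Finset.mul_sum, Finset.sum_comm]
    simp only [ih, ← Finset.mul_sum]
    ring

end Khinchine

/-! ### Hölder's inequality and interpolation of mixed norms -/

section Interpolation

/-- Hölder's inequality for finite sums and finitely many factors. -/
lemma sum_mul_prod_rpow_le {α ι : Type*} [Fintype α] [Fintype ι] (g : α → ℝ≥0∞)
    (f : ι → α → ℝ≥0∞) {q : ℝ} {p : ι → ℝ} (hpq : q + ∑ i, p i = 1) (hq : 0 ≤ q)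
    (hp : ∀ i, 0 ≤ p i) :
    ∑ a, g a ^ q * ∏ i, f i a ^ p i ≤ (∑ a, g a) ^ q * ∏ i, (∑ a, f i a) ^ p i := by
  let _ : MeasurableSpace α := ⊤
  have := ENNReal.lintegral_mul_prod_norm_pow_le (μ := MeasureTheory.Measure.count) Finset.univ
    (g := g) (f := f) (measurable_from_top.aemeasurable)
    (fun i _ => measurable_from_top.aemeasurable) q hpq hq (fun i _ => hp i)
  simpa [MeasureTheory.lintegral_count, tsum_fintype] using this

/-- Blei's interpolation inequality for the mixed `ℓ¹(ℓ²)` norms. Writing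
`S s t = (∑_{j s = t} (a j)²) ^ (1/2)`, it is Hölder's inequality with `M + 1` factors applied to
`a j ^ (2M) = ∏ s, S s (j s) * ∏ s, ((a j)² / S s (j s))`. -/
lemma sum_rpow_le_of_mixed_sum_le {M N : ℕ} (hM : 1 ≤ M) (a : (Fin M → Fin N) → ℝ≥0∞)
    (ha : ∀ j, a j ≠ ∞) (K : ℝ≥0∞)
    (hK : ∀ s, ∑ t, (∑ j with j s = t, a j ^ 2) ^ (1 / 2 : ℝ) ≤ K) :
    ∑ j, a j ^ (2 * (M : ℝ) / (M + 1)) ≤ K ^ (2 * (M : ℝ) / (M + 1)) := by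
  set S : Fin M → Fin N → ℝ≥0∞ := fun s t => (∑ j with j s = t, a j ^ 2) ^ (1 / 2 : ℝ) with hS
  have hM0 : (0 : ℝ) < M + 1 := by positivity
  have hS2 (s t) : ∑ j with j s = t, a j ^ 2 = S s t ^ 2 := by
    simp only [hS]
    rw [← ENNReal.rpow_natCast, ← ENNReal.rpow_mul]
    norm_num
  have hStop (s t) : S s t ≠ ∞ := by
    refine ENNReal.rpow_ne_top_of_nonneg (by norm_num) (ENNReal.sum_ne_top.2 fun j _ => ?_)
    exact ENNReal.pow_ne_top (ha j)
  have hzero (s j) (h : S s (j s) = 0) : a j = 0 := by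
    have h1 := hS2 s (j s)
    rw [h] at h1
    simp only [ne_eq, OfNat.ofNat_ne_zero, not_false_eq_true, zero_pow,
      Finset.sum_eq_zero_iff, Finset.mem_filter, Finset.mem_univ, true_and] at h1
    simpa using h1 j rfl
  have hpt (j) : a j ^ (2 * (M : ℝ) / (M + 1)) =
      (∏ s, S s (j s)) ^ (1 / ((M : ℝ) + 1)) *
        ∏ s, (a j ^ 2 / S s (j s)) ^ (1 / ((M : ℝ) + 1)) := by
    have h1 (s) : S s (j s) * (a j ^ 2 / S s (j s)) = a j ^ 2 := by
      by_cases h : S s (j s) = 0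
      · simp [h, hzero s j h]
      · exact ENNReal.mul_div_cancel h (hStop _ _)
    rw [ENNReal.prod_rpow_of_nonneg (f := fun s => a j ^ 2 / S s (j s)) (by positivity),
      ← ENNReal.mul_rpow_of_nonneg _ _ (by positivity),
      ← Finset.prod_mul_distrib]
    simp only [h1, Finset.prod_const, Finset.card_univ, Fintype.card_fin]
    rw [← pow_mul, ← ENNReal.rpow_natCast, ← ENNReal.rpow_mul]
    congr 1
    push_cast
    ring
  have hfib (s) : ∑ j, a j ^ 2 / S s (j s) = ∑ t, S s t := by
    rw [← Finset.sum_fiberwise Finset.univ (fun j : Fin M → Fin N => j s)]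
    refine Finset.sum_congr rfl fun t _ => ?_
    have : ∑ j with j s = t, a j ^ 2 / S s (j s) = ∑ j with j s = t, a j ^ 2 * (S s t)⁻¹ :=
      Finset.sum_congr rfl fun j hj => by
        rw [(Finset.mem_filter.1 hj).2, div_eq_mul_inv]
    rw [this, ← Finset.sum_mul, hS2]
    by_cases h : S s t = 0
    · simp [h]
    · rw [sq, mul_assoc, ENNReal.mul_inv_cancel h (hStop s t), mul_one]
  have hprod : ∑ j : Fin M → Fin N, ∏ s, S s (j s) = ∏ s, ∑ t, S s t := by
    rw [Finset.prod_univ_sum, Fintype.piFinset_univ]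
  calc ∑ j, a j ^ (2 * (M : ℝ) / (M + 1))
      ≤ (∑ j : Fin M → Fin N, ∏ s, S s (j s)) ^ (1 / ((M : ℝ) + 1)) *
        ∏ s, (∑ j, a j ^ 2 / S s (j s)) ^ (1 / ((M : ℝ) + 1)) := by
        simp only [hpt]
        refine sum_mul_prod_rpow_le _ _ ?_ (by positivity) fun _ => by positivity
        simp only [Finset.sum_const, Finset.card_univ, Fintype.card_fin, nsmul_eq_mul]
        field_simp
        ring
    _ ≤ (∏ _s : Fin M, K) ^ (1 / ((M : ℝ) + 1)) * ∏ _s : Fin M, K ^ (1 / ((M : ℝ) + 1)) := by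
        rw [hprod]
        simp only [hfib]
        gcongr <;> exact hK _
    _ = K ^ (2 * (M : ℝ) / (M + 1)) := by
        simp only [Finset.prod_const, Finset.card_univ, Fintype.card_fin]
        rw [← ENNReal.rpow_natCast, ← ENNReal.rpow_natCast, ← ENNReal.rpow_mul, ← ENNReal.rpow_mul,
          ← ENNReal.rpow_add_of_nonneg _ _ (by positivity) (by positivity)]
        congr 1
        ring

end Interpolation

/-! ### Forms bounded on sign vectors and the Bohnenblust–Hille inequality -/

section SignBounds

/-- The array `A` of coefficients defines an `m`-linear form bounded by `K` on sign vectors. -/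
def SignBounded {m N : ℕ} {E : Type*} [NormedAddCommGroup E] (A : (Fin m → Fin N) → E)
    (K : ℝ) : Prop :=
  ∀ ε : Fin m → Fin N → ℤˣ, ‖∑ i, (∏ k, ε k (i k)) • A i‖ ≤ K

lemma sum_signs_mul {N : ℕ} (s t : Fin N) :
    ∑ δ : Fin N → ℤˣ, ((δ s * δ t : ℤˣ) : ℤ) = if s = t then 2 ^ N else 0 := by
  split_ifs with h
  · subst h
    simp [Int.units_mul_self]
  · -- flipping the sign `δ s` changes the sign of the summand
    have e := Equiv.sum_comp (Equiv.mulLeft (Pi.mulSingle s (-1) : Fin N → ℤˣ))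
      (fun δ : Fin N → ℤˣ => ((δ s * δ t : ℤˣ) : ℤ))
    simp only [Equiv.coe_mulLeft, Pi.mul_apply, Pi.mulSingle_eq_same,
      Pi.mulSingle_eq_of_ne (Ne.symm h), one_mul, neg_mul, Units.val_neg, Finset.sum_neg_distrib]
      at e
    omega

variable {𝕜 : Type*} [RCLike 𝕜] {m N : ℕ}

/-- Averaging over signs restricts a form to the indices `j ∘ f` that are constant on the fibres
of `f`: identifying the variables of a form according to `f` does not increase its bound on sign
vectors. -/
lemma SignBounded.comp_surjective {M : ℕ} {A : (Fin m → Fin N) → 𝕜} {K : ℝ}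
    (hA : SignBounded A K) {f : Fin m → Fin M} (hf : f.Surjective) :
    SignBounded (fun j : Fin M → Fin N => A (j ∘ f)) K := by
  intro ε
  obtain ⟨g, hg⟩ := hf.hasRightInverse
  -- The variable `g s` carries the signs `ε s` and those of its whole fibre, so that the product
  -- over all variables pairs `δ k (i k)` with `δ k (i (g (f k)))`; its average over `δ` vanishes
  -- unless `i` is constant on the fibres of `f`.
  let x : (Fin m → Fin N → ℤˣ) → Fin m → Fin N → ℤˣ := fun δ k t =>
    δ k t * ∏ s with g s = k, (ε s t * ∏ k' with f k' = s, δ k' t)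
  have hx (δ : Fin m → Fin N → ℤˣ) (i : Fin m → Fin N) : ∏ k, x δ k (i k) =
      (∏ s, ε s (i (g s))) * ∏ k, (δ k (i k) * δ k (i (g (f k)))) := by
    have h1 : ∏ k, ∏ s with g s = k, (ε s (i k) * ∏ k' with f k' = s, δ k' (i k)) =
        ∏ s, (ε s (i (g s)) * ∏ k' with f k' = s, δ k' (i (g s))) := by
      rw [← Finset.prod_fiberwise Finset.univ g]
      exact Finset.prod_congr rfl fun k _ => Finset.prod_congr rfl fun s hs => by
        rw [(Finset.mem_filter.1 hs).2]
    have h2 : ∏ s, ∏ k' with f k' = s, δ k' (i (g s)) = ∏ k, δ k (i (g (f k))) := by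
      rw [← Finset.prod_fiberwise Finset.univ f]
      exact Finset.prod_congr rfl fun k _ => Finset.prod_congr rfl fun s hs => by
        rw [(Finset.mem_filter.1 hs).2]
    simp only [x, Finset.prod_mul_distrib] at h1 ⊢
    rw [h1, h2]
    ac_rfl
  have havg (i : Fin m → Fin N) :
      ∑ δ : Fin m → Fin N → ℤˣ, ((∏ k, (δ k (i k) * δ k (i (g (f k)))) : ℤˣ) : ℤ) =
        if i = i ∘ g ∘ f then (2 ^ N) ^ m else 0 := by
    simp only [Units.coe_prod]
    rw [← Fintype.piFinset_univ, ← Finset.prod_univ_sum (fun _ => Finset.univ)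
      (fun k (δ : Fin N → ℤˣ) => ((δ (i k) * δ (i (g (f k))) : ℤˣ) : ℤ))]
    simp only [sum_signs_mul]
    split_ifs with h
    · have h' (k) : i k = i (g (f k)) := congrFun h k
      simp [← h']
    · obtain ⟨k, hk⟩ := Function.ne_iff.1 h
      exact Finset.prod_eq_zero (Finset.mem_univ k) (if_neg hk)
  have hsum : ∑ δ : Fin m → Fin N → ℤˣ, ∑ i, (∏ k, x δ k (i k)) • A i =
      ((2 ^ N) ^ m : ℕ) • ∑ j : Fin M → Fin N, (∏ s, ε s (j s)) • A (j ∘ f) := by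
    rw [Finset.sum_comm]
    have h1 (i : Fin m → Fin N) : ∑ δ, (∏ k, x δ k (i k)) • A i =
        if i = i ∘ g ∘ f then ((2 ^ N) ^ m : ℕ) • (∏ s, ε s (i (g s))) • A i else 0 := by
      simp only [hx, mul_smul, ← Finset.smul_sum]
      have : ∑ δ : Fin m → Fin N → ℤˣ, (∏ k, (δ k (i k) * δ k (i (g (f k))))) • A i =
          (∑ δ : Fin m → Fin N → ℤˣ,
            ((∏ k, (δ k (i k) * δ k (i (g (f k)))) : ℤˣ) : ℤ)) • A i := by
        rw [Finset.sum_smul]; rfl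
      rw [this, havg]
      split_ifs
      · rw [smul_comm, ← natCast_zsmul]
        push_cast
        rfl
      · simp
    simp only [h1]
    rw [← Finset.sum_filter, Finset.smul_sum]
    symm
    refine Finset.sum_nbij' (fun j => j ∘ f) (fun i => i ∘ g) ?_ ?_ ?_ ?_ ?_
    · intro j _
      simp only [Finset.mem_filter, Finset.mem_univ, true_and]
      funext k
      simp [hg (f k)]
    · simp
    · intro j _
      funext s
      simp [hg s]
    · intro i hi
      exact (Finset.mem_filter.1 hi).2.symm
    · intro j _
      simp [hg _]
  have hle : ‖((2 ^ N) ^ m : ℕ) • ∑ j : Fin M → Fin N, (∏ s, ε s (j s)) • A (j ∘ f)‖ ≤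
      ((2 ^ N) ^ m : ℕ) * K := by
    rw [← hsum]
    refine (norm_sum_le_of_le _ fun δ _ => hA (x δ)).trans_eq ?_
    simp [Fintype.card_pi]
  rw [RCLike.norm_nsmul 𝕜] at hle
  exact le_of_mul_le_mul_left (by simpa using hle) (show (0 : ℝ) < (2 ^ N) ^ m by positivity)

lemma sum_norm_le_two_mul_of_signs {z : Fin N → 𝕜} {K : ℝ}
    (hz : ∀ δ : Fin N → ℤˣ, ‖∑ t, δ t • z t‖ ≤ K) : ∑ t, ‖z t‖ ≤ 2 * K := by
  have key (ψ : 𝕜 →+ ℝ) (hψ : ∀ z, |ψ z| ≤ ‖z‖) : ∑ t, |ψ (z t)| ≤ K := by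
    let δ : Fin N → ℤˣ := fun t => if 0 ≤ ψ (z t) then 1 else -1
    refine le_trans (le_of_eq ?_) ((le_abs_self _).trans ((hψ _).trans (hz δ)))
    rw [map_sum]
    refine Finset.sum_congr rfl fun t _ => ?_
    by_cases h : 0 ≤ ψ (z t)
    · simp [δ, h]
    · simp [δ, h, abs_of_neg (not_le.1 h)]
  have hle (w : 𝕜) : ‖w‖ ≤ |RCLike.re w| + |RCLike.im w| := by
    conv_lhs => rw [← RCLike.re_add_im w]
    refine (norm_add_le _ _).trans ?_
    rw [norm_mul, RCLike.norm_ofReal, RCLike.norm_ofReal]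
    gcongr
    refine mul_le_of_le_one_right (abs_nonneg _) ?_
    by_cases h : (RCLike.I : 𝕜) = 0
    · simp [h]
    · exact (RCLike.norm_I_of_ne_zero h).le
  calc ∑ t, ‖z t‖ ≤ ∑ t, (|RCLike.re (z t)| + |RCLike.im (z t)|) :=
        Finset.sum_le_sum fun t _ => hle _
    _ ≤ 2 * K := by
        rw [Finset.sum_add_distrib, two_mul]
        exact add_le_add (key RCLike.re RCLike.abs_re_le_norm) (key RCLike.im RCLike.abs_im_le_norm)

lemma SignBounded.nonneg {A : (Fin m → Fin N) → 𝕜} {K : ℝ} (hA : SignBounded A K) : 0 ≤ K :=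
  (norm_nonneg _).trans (hA 1)

/-- The mixed `ℓ¹(ℓ²)` inequality: Khinchine's inequality is applied, for each `t`, to the part of
the form with `j s = t`; summing over `t` costs nothing, as the signs of the variable `s` may be
changed independently for each `t`. -/
lemma SignBounded.mixed_sum_le {M : ℕ} {A : (Fin M → Fin N) → 𝕜} {K : ℝ} (hA : SignBounded A K)
    (s : Fin M) : ∑ t, √(∑ j with j s = t, ‖A j‖ ^ 2) ≤ 2 ^ (M + 1) * K := by
  have h1 (t : Fin N) : (2 ^ N) ^ M * √(∑ j with j s = t, ‖A j‖ ^ 2) ≤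
      2 ^ M * ∑ ε : Fin M → Fin N → ℤˣ, ‖∑ j with j s = t, (∏ r, ε r (j r)) • A j‖ := by
    have := sqrt_sum_sq_le_sum_signs_chaos 𝕜 M N fun j => if j s = t then A j else 0
    simpa only [smul_ite, smul_zero, apply_ite norm, norm_zero, ite_pow, ne_eq,
      OfNat.ofNat_ne_zero, not_false_eq_true, zero_pow, ← Finset.sum_filter] using this
  have h2 (ε : Fin M → Fin N → ℤˣ) :
      ∑ t, ‖∑ j with j s = t, (∏ r, ε r (j r)) • A j‖ ≤ 2 * K := by
    refine sum_norm_le_two_mul_of_signs fun δ => ?_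
    refine (le_of_eq (congrArg norm ?_)).trans (hA (Function.update ε s (δ * ε s)))
    rw [← Finset.sum_fiberwise Finset.univ (fun j : Fin M → Fin N => j s)]
    refine Finset.sum_congr rfl fun t _ => ?_
    rw [Finset.smul_sum]
    refine Finset.sum_congr rfl fun j hj => ?_
    rw [smul_smul, ← Finset.mul_prod_erase _ _ (Finset.mem_univ s),
      ← Finset.mul_prod_erase _ _ (Finset.mem_univ s), ← mul_assoc]
    congr 2
    · simp [(Finset.mem_filter.1 hj).2]
    · exact Finset.prod_congr rfl fun r hr => by
        rw [Function.update_of_ne (Finset.ne_of_mem_erase hr)]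
  have h3 : (2 ^ N) ^ M * ∑ t, √(∑ j with j s = t, ‖A j‖ ^ 2) ≤
      (2 ^ N) ^ M * (2 ^ (M + 1) * K) := by
    calc _ ≤ ∑ t, 2 ^ M * ∑ ε : Fin M → Fin N → ℤˣ,
          ‖∑ j with j s = t, (∏ r, ε r (j r)) • A j‖ := by
          rw [Finset.mul_sum]
          exact Finset.sum_le_sum fun t _ => h1 t
      _ = 2 ^ M * ∑ ε : Fin M → Fin N → ℤˣ, ∑ t,
          ‖∑ j with j s = t, (∏ r, ε r (j r)) • A j‖ := by
          rw [← Finset.mul_sum, Finset.sum_comm]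
      _ ≤ 2 ^ M * ∑ _ε : Fin M → Fin N → ℤˣ, 2 * K := by
          gcongr with ε _
          exact h2 ε
      _ = _ := by
          simp [Fintype.card_pi]
          ring
  exact le_of_mul_le_mul_left h3 (by positivity)

/-- The Bohnenblust–Hille inequality for arrays, with constant `2 ^ (M + 1)`. -/
lemma SignBounded.sum_rpow_le {M : ℕ} (hM : 1 ≤ M) {A : (Fin M → Fin N) → 𝕜} {K : ℝ}
    (hA : SignBounded A K) :
    ∑ j, ‖A j‖ₑ ^ (2 * (M : ℝ) / (M + 1)) ≤
      (2 ^ (M + 1) * ENNReal.ofReal K) ^ (2 * (M : ℝ) / (M + 1)) := by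
  refine sum_rpow_le_of_mixed_sum_le hM _ (fun j => enorm_ne_top) _ fun s => ?_
  have h (t : Fin N) : (∑ j with j s = t, ‖A j‖ₑ ^ 2) ^ (1 / 2 : ℝ) =
      ENNReal.ofReal √(∑ j with j s = t, ‖A j‖ ^ 2) := by
    rw [Real.sqrt_eq_rpow, ← ENNReal.ofReal_rpow_of_nonneg (by positivity) (by norm_num),
      ENNReal.ofReal_sum_of_nonneg fun _ _ => by positivity]
    simp only [ENNReal.ofReal_pow (norm_nonneg _), ofReal_norm]
  simp only [h]
  rw [← ENNReal.ofReal_sum_of_nonneg fun _ _ => by positivity]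
  refine (ENNReal.ofReal_le_ofReal (hA.mixed_sum_le s)).trans_eq ?_
  rw [ENNReal.ofReal_mul (by positivity), ENNReal.ofReal_pow (by norm_num)]
  norm_num

lemma SignBounded.sum_sq_le {A : (Fin m → Fin N) → 𝕜} {K : ℝ} (hA : SignBounded A K) :
    ∑ i, ‖A i‖ₑ ^ 2 ≤ ENNReal.ofReal K ^ 2 := by
  have h : ∑ i, ‖A i‖ ^ 2 ≤ K ^ 2 := by
    refine le_of_mul_le_mul_left ?_ (show (0 : ℝ) < (2 ^ N) ^ m by positivity)
    rw [← sum_signs_chaos_norm_sq 𝕜]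
    refine (Finset.sum_le_sum fun ε _ => pow_le_pow_left₀ (norm_nonneg _) (hA ε) 2).trans_eq ?_
    simp [Fintype.card_pi]
  have h2 := ENNReal.ofReal_le_ofReal h
  rw [ENNReal.ofReal_sum_of_nonneg fun _ _ => by positivity, ENNReal.ofReal_pow hA.nonneg] at h2
  simpa only [ENNReal.ofReal_pow (norm_nonneg _), ofReal_norm] using h2

end SignBounds

/-! ### Indices with few distinct entries -/

section FewDistinctEntries

/-- As `M ≤ m`, the map `f` can be taken surjective even if `i` has fewer than `M` values: the set
of chosen representatives of the values of `i` is enlarged to exactly `M` positions. -/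
lemma exists_surjective_comp_eq {m M N : ℕ} (hm : M ≤ m) (i : Fin m → Fin N)
    (hi : (Set.range i).ncard ≤ M) :
    ∃ (f : Fin m → Fin M) (j : Fin M → Fin N), f.Surjective ∧ j ∘ f = i := by
  classical
  let r : Fin m → Fin m := fun k => Set.rangeSplitting i ⟨i k, k, rfl⟩
  have hr (k) : i (r k) = i k := Set.apply_rangeSplitting i _
  let R : Finset (Fin m) := Finset.univ.image r
  have hR : R.card ≤ M := by
    refine le_trans ?_ hi
    rw [Set.ncard_eq_toFinset_card' (Set.range i), Set.toFinset_card,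
      ← Finset.card_univ]
    have : R ⊆ Finset.univ.image (Set.rangeSplitting i) := by
      intro k hk
      obtain ⟨l, _, rfl⟩ := Finset.mem_image.1 hk
      exact Finset.mem_image_of_mem _ (Finset.mem_univ _)
    exact (Finset.card_le_card this).trans Finset.card_image_le
  obtain ⟨S, hRS, hS⟩ := Finset.exists_superset_card_eq hR (by simpa using hm)
  let e := S.equivFinOfCardEq hS
  have hrS (k) : r k ∈ S := hRS (Finset.mem_image_of_mem _ (Finset.mem_univ k))
  refine ⟨fun k => if h : k ∈ S then e ⟨k, h⟩ else e ⟨r k, hrS k⟩, fun s => i (e.symm s),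
    fun s => ⟨e.symm s, by simp⟩, ?_⟩
  funext k
  by_cases h : k ∈ S
  · simp [h]
  · simp [h, hr]

variable {𝕜 : Type*} [RCLike 𝕜] {m N : ℕ}

/-- Each index with at most `M` distinct entries is `j ∘ f` for some surjection `f` onto `Fin M`,
and there are at most `M ^ m` of these; the form with its variables identified according to `f` is
`M`-linear and obeys the Bohnenblust–Hille inequality. -/
lemma SignBounded.sum_rpow_low_le {M : ℕ} (hM : 1 ≤ M) (hm : M ≤ m) {A : (Fin m → Fin N) → 𝕜}
    {K : ℝ} (hA : SignBounded A K) :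
    ∑ i with (Set.range i).ncard ≤ M, ‖A i‖ₑ ^ (2 * (M : ℝ) / (M + 1)) ≤
      M ^ m * (2 ^ (M + 1) * ENNReal.ofReal K) ^ (2 * (M : ℝ) / (M + 1)) := by
  classical
  set G : Finset (Fin m → Fin N) := {i | (Set.range i).ncard ≤ M}
  set F : Finset (Fin m → Fin M) := {f | f.Surjective} with hF
  set h : (Fin m → Fin N) → ℝ≥0∞ := fun i => ‖A i‖ₑ ^ (2 * (M : ℝ) / (M + 1))
  calc ∑ i ∈ G, h i
      ≤ ∑ i ∈ (F ×ˢ Finset.univ).image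
          (fun x : (Fin m → Fin M) × (Fin M → Fin N) => x.2 ∘ x.1), h i := by
        refine Finset.sum_le_sum_of_subset fun i hi => ?_
        obtain ⟨f, j, hf, rfl⟩ := exists_surjective_comp_eq hm i (Finset.mem_filter.1 hi).2
        exact Finset.mem_image.2 ⟨(f, j), by simp [hF, hf], rfl⟩
    _ ≤ ∑ x ∈ F ×ˢ (Finset.univ : Finset (Fin M → Fin N)), h (x.2 ∘ x.1) :=
        Finset.sum_image_le_of_nonneg (fun _ _ => zero_le)
    _ = ∑ f ∈ F, ∑ j : Fin M → Fin N, h (j ∘ f) := Finset.sum_product _ _ _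
    _ ≤ ∑ _f ∈ F, (2 ^ (M + 1) * ENNReal.ofReal K) ^ (2 * (M : ℝ) / (M + 1)) :=
        Finset.sum_le_sum fun f hf =>
          (hA.comp_surjective (Finset.mem_filter.1 hf).2).sum_rpow_le hM
    _ ≤ _ := by
        rw [Finset.sum_const, nsmul_eq_mul]
        gcongr
        have : F.card ≤ M ^ m := (Finset.card_le_univ F).trans_eq (by simp)
        exact_mod_cast this

/-- The `ℓ^p` norm, `p = 2m/(m+1)`, is interpolated between `ℓ^q`, `q = 2M/(M+1)`, and `ℓ²`. The
weight `θ = (M+1)/(m+1)` of the first is so small that the number `M ^ m` of surjections only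
contributes `M ^ ((M+1)/2)`. -/
lemma SignBounded.sum_rpow_few_le {M : ℕ} (hM : 1 ≤ M) (hm : M ≤ m) {A : (Fin m → Fin N) → 𝕜}
    {K : ℝ} (hA : SignBounded A K) :
    ∑ i with (Set.range i).ncard ≤ M, ‖A i‖ₑ ^ (2 * (m : ℝ) / (m + 1)) ≤
      ((M : ℝ≥0∞) ^ (((M : ℝ) + 1) / 2) * (2 ^ (M + 1)) ^ ((M : ℝ) / m) * ENNReal.ofReal K) ^
        (2 * (m : ℝ) / (m + 1)) := by
  set G : Finset (Fin m → Fin N) := {i | (Set.range i).ncard ≤ M}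
  set q : ℝ := 2 * (M : ℝ) / (M + 1) with hq
  set θ : ℝ := ((M : ℝ) + 1) / (m + 1) with hθ
  have hm0 : (0 : ℝ) < m := by exact_mod_cast hM.trans hm
  have hM0 : (0 : ℝ) < M := by exact_mod_cast hM
  have hmM : (M : ℝ) ≤ m := by exact_mod_cast hm
  have hq0 : 0 ≤ q := by positivity
  have hθ0 : 0 ≤ θ := by positivity
  have hθ1 : 0 ≤ 1 - θ := by
    rw [sub_nonneg, hθ, div_le_one (by positivity)]
    linarith
  have hexp : q * θ + 2 * (1 - θ) = 2 * (m : ℝ) / (m + 1) := by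
    rw [hq, hθ]; field_simp; ring
  have h1 : ∑ i ∈ G, ‖A i‖ₑ ^ (2 * (m : ℝ) / (m + 1)) ≤
      (∑ i ∈ G, ‖A i‖ₑ ^ q) ^ θ * (∑ i ∈ G, ‖A i‖ₑ ^ 2) ^ (1 - θ) := by
    have := sum_mul_prod_rpow_le (α := G) (ι := Unit) (fun i => ‖A i‖ₑ ^ q)
      (fun _ i => ‖A i‖ₑ ^ 2) (q := θ) (p := fun _ => 1 - θ) (by simp) hθ0 (fun _ => hθ1)
    simp only [Finset.univ_unique, Finset.prod_singleton] at this
    rw [Finset.sum_coe_sort G fun i => (‖A i‖ₑ ^ q) ^ θ * (‖A i‖ₑ ^ 2) ^ (1 - θ),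
      Finset.sum_coe_sort G fun i => ‖A i‖ₑ ^ q, Finset.sum_coe_sort G fun i => ‖A i‖ₑ ^ 2] at this
    refine le_trans (le_of_eq (Finset.sum_congr rfl fun i _ => ?_)) this
    rw [← ENNReal.rpow_natCast, ← ENNReal.rpow_mul, ← ENNReal.rpow_mul,
      ← ENNReal.rpow_add_of_nonneg _ _ (by positivity) (by positivity), ← hexp]
    norm_num
  have h2 : ∑ i ∈ G, ‖A i‖ₑ ^ 2 ≤ ENNReal.ofReal K ^ 2 :=
    (Finset.sum_le_sum_of_subset (Finset.subset_univ _)).trans hA.sum_sq_le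
  calc _ ≤ (M ^ m * (2 ^ (M + 1) * ENNReal.ofReal K) ^ q) ^ θ *
        (ENNReal.ofReal K ^ 2) ^ (1 - θ) := by
        refine h1.trans ?_
        gcongr
        exact hA.sum_rpow_low_le hM hm
    _ = _ := by
        generalize ENNReal.ofReal K = K
        have e1 : ((M : ℝ≥0∞) ^ m) ^ θ =
            ((M : ℝ≥0∞) ^ (((M : ℝ) + 1) / 2)) ^ (2 * (m : ℝ) / (m + 1)) := by
          rw [← ENNReal.rpow_natCast, ← ENNReal.rpow_mul, ← ENNReal.rpow_mul]
          congr 1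
          rw [hθ]; field_simp
        have e2 : (((2 : ℝ≥0∞) ^ (M + 1)) ^ q) ^ θ =
            (((2 : ℝ≥0∞) ^ (M + 1)) ^ ((M : ℝ) / m)) ^ (2 * (m : ℝ) / (m + 1)) := by
          rw [← ENNReal.rpow_mul, ← ENNReal.rpow_mul]
          congr 1
          rw [hθ, hq]; field_simp
        have e3 : (K ^ q) ^ θ * (K ^ 2) ^ (1 - θ) = K ^ (2 * (m : ℝ) / (m + 1)) := by
          rw [← ENNReal.rpow_natCast, ← ENNReal.rpow_mul, ← ENNReal.rpow_mul,
            ← ENNReal.rpow_add_of_nonneg _ _ (by positivity) (by positivity), ← hexp]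
          norm_num
        rw [ENNReal.mul_rpow_of_nonneg _ _ (by positivity : (0 : ℝ) ≤ 2 * (m : ℝ) / (m + 1)),
          ENNReal.mul_rpow_of_nonneg _ _ (by positivity : (0 : ℝ) ≤ 2 * (m : ℝ) / (m + 1)),
          ENNReal.mul_rpow_of_nonneg _ _ hθ0, ENNReal.mul_rpow_of_nonneg _ _ hq0,
          ENNReal.mul_rpow_of_nonneg _ _ hθ0, ← e1, ← e2, ← e3]
        ring

end FewDistinctEntries

/-! ### Multilinear forms on `c₀` -/

section Forms

variable {𝕜 : Type*} [RCLike 𝕜]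

/-- Evaluation at a point, as a continuous linear functional on `c₀`. -/
noncomputable def evalCLM (𝕜 : Type*) [RCLike 𝕜] (t : ℕ) : C₀(ℕ, 𝕜) →L[𝕜] 𝕜 :=
  LinearMap.mkContinuous
    { toFun := fun x => x t
      map_add' := fun _ _ => rfl
      map_smul' := fun _ _ => rfl } 1
    fun x => by
      rw [one_mul, ← ZeroAtInftyContinuousMap.norm_toBCF_eq_norm]
      exact x.toBCF.norm_coe_le_norm t

@[simp]
lemma evalCLM_apply (t : ℕ) (x : C₀(ℕ, 𝕜)) : evalCLM 𝕜 t x = x t := rfl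

lemma norm_apply_le (x : C₀(ℕ, 𝕜)) (t : ℕ) : ‖x t‖ ≤ ‖x‖ := by
  rw [← ZeroAtInftyContinuousMap.norm_toBCF_eq_norm]
  exact x.toBCF.norm_coe_le_norm t

lemma unitVec_apply (j t : ℕ) : unitVec 𝕜 j t = if t = j then 1 else 0 :=
  Pi.single_apply j (1 : 𝕜) t

lemma norm_sum_signs_unitVec_le {N : ℕ} (ε : Fin N → ℤˣ) :
    ‖∑ t, ε t • unitVec 𝕜 (t : ℕ)‖ ≤ 1 := by
  rw [← ZeroAtInftyContinuousMap.norm_toBCF_eq_norm,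
    BoundedContinuousFunction.norm_le zero_le_one]
  intro s
  change ‖evalCLM 𝕜 s (∑ t, ε t • unitVec 𝕜 (t : ℕ))‖ ≤ 1
  have h (t : Fin N) : evalCLM 𝕜 s (ε t • unitVec 𝕜 (t : ℕ)) = if s = t then ε t • 1 else 0 := by
    rw [Units.smul_def, map_zsmul, evalCLM_apply, unitVec_apply]
    split_ifs <;> simp [Units.smul_def]
  rw [map_sum, Finset.sum_congr rfl fun t _ => h t]
  by_cases hs : s < N
  · rw [Finset.sum_eq_single ⟨s, hs⟩]
    · simp
    · intro t _ ht
      exact if_neg fun h => ht (Fin.ext h.symm)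
    · simp
  · rw [Finset.sum_eq_zero]
    · simp
    · intro t _
      exact if_neg fun h : s = (t : ℕ) => hs (h ▸ t.2)

lemma intUnits_smul_eq_smul (R : Type*) {V : Type*} [Ring R] [AddCommGroup V] [Module R V]
    (u : ℤˣ) (v : V) : u • v = ((u : ℤ) : R) • v := by
  rw [Units.smul_def, Int.cast_smul_eq_zsmul]

lemma signBounded_form {m : ℕ} (T : Form 𝕜 m) (N : ℕ) :
    SignBounded (fun i : Fin m → Fin N => T fun k => unitVec 𝕜 (i k)) ‖T‖ := by
  intro ε
  have h : ∑ i : Fin m → Fin N, (∏ k, ε k (i k)) • (T fun k => unitVec 𝕜 (i k)) =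
      T fun k => ∑ t, ε k t • unitVec 𝕜 (t : ℕ) := by
    rw [T.map_sum]
    refine Finset.sum_congr rfl fun i _ => ?_
    simp only [intUnits_smul_eq_smul 𝕜]
    rw [T.map_smul_univ]
    simp
  rw [h]
  refine (T.le_opNorm _).trans (mul_le_of_le_one_right (norm_nonneg _) ?_)
  exact Finset.prod_le_one (fun _ _ => norm_nonneg _) fun k _ => norm_sum_signs_unitVec_le _

theorem restrictedSum_le {m M : ℕ} (hM : 1 ≤ M) (hm : M ≤ m) (T : Form 𝕜 m) :
    restrictedSum M T ≤
      (M : ℝ≥0∞) ^ (((M : ℝ) + 1) / 2) * (2 ^ (M + 1)) ^ ((M : ℝ) / m) * ‖T‖ₑ := by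
  classical
  have hm0 : (0 : ℝ) < m := by exact_mod_cast hM.trans hm
  set C := (M : ℝ≥0∞) ^ (((M : ℝ) + 1) / 2) * (2 ^ (M + 1)) ^ ((M : ℝ) / m) * ‖T‖ₑ with hC
  set p : ℝ := 2 * (m : ℝ) / (m + 1) with hp
  have hpp : C = (C ^ p) ^ (((m : ℝ) + 1) / (2 * m)) := by
    rw [← ENNReal.rpow_mul, hp, div_mul_div_cancel₀ (by positivity), div_self (by positivity),
      ENNReal.rpow_one]
  rw [restrictedSum, hpp]
  refine ENNReal.rpow_le_rpow ?_ (by positivity)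
  rw [ENNReal.tsum_eq_iSup_sum]
  refine iSup_le fun F => ?_
  -- `N` exceeds all entries of the finitely many indices in `F`
  obtain ⟨N, hN⟩ : ∃ N : ℕ, ∀ x ∈ F, ∀ k, x.1 k < N := by
    refine ⟨F.sup (fun x => Finset.univ.sup x.1) + 1, fun x hx k => Nat.lt_succ_of_le ?_⟩
    exact (Finset.le_sup (Finset.mem_univ k)).trans
      (Finset.le_sup (f := fun x : {i : Fin m → ℕ // (Set.range i).ncard ≤ M} =>
        Finset.univ.sup x.1) hx)
  let e : (Fin m → Fin N) → Fin m → ℕ := fun i k => i k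
  have he : Function.Injective e := fun i j h => funext fun k => Fin.ext (congrFun h k)
  let w : (Fin m → ℕ) → ℝ≥0∞ := fun i => ‖T fun k => unitVec 𝕜 (i k)‖ₑ ^ p
  calc ∑ x ∈ F, w x.1 = ∑ i ∈ F.image Subtype.val, w i :=
        (Finset.sum_image Subtype.val_injective.injOn).symm
    _ ≤ ∑ i ∈ ({i | (Set.range i).ncard ≤ M} : Finset (Fin m → Fin N)).image e, w i := by
        refine Finset.sum_le_sum_of_subset fun i hi => ?_
        obtain ⟨x, hx, rfl⟩ := Finset.mem_image.1 hi
        refine Finset.mem_image.2 ⟨fun k => ⟨x.1 k, hN x hx k⟩, ?_, rfl⟩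
        simp only [Finset.mem_filter, Finset.mem_univ, true_and]
        refine le_trans (le_of_eq ?_) x.2
        rw [← Set.ncard_image_of_injective _ (Fin.val_injective (n := N)), ← Set.range_comp]
        rfl
    _ = ∑ i : Fin m → Fin N with (Set.range i).ncard ≤ M,
          ‖T fun k => unitVec 𝕜 (i k)‖ₑ ^ p := Finset.sum_image he.injOn
    _ ≤ C ^ p := by
        have := (signBounded_form T N).sum_rpow_few_le hM hm
        have hT : ENNReal.ofReal ‖T‖ = ‖T‖ₑ := ofReal_norm T
        rw [hC, ← hT]
        exact this

end Forms

/-! ### Forms giving the lower bounds -/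

section Extremal

/-- The index `(b, φ c)` of the coefficient of the form `walshForm φ` belonging to `c` and `b`. -/
def walshIndex {h r : ℕ} (φ : (Fin h → Bool) → Fin r → ℕ) (c b : Fin h → Bool) :
    Fin (h + r) → ℕ :=
  Fin.append (fun l => (b l).toNat) (φ c)

/-- The Walsh sign `(-1) ^ ⟨c, b⟩`. -/
noncomputable def walshSign {h : ℕ} (c b : Fin h → Bool) : ℝ :=
  ∏ l, if c l && b l then -1 else 1

/-- The form `∑_c (∏ k, y k (φ c k)) * ∏ l, (x l 0 + (-1) ^ (c l) * x l 1)` in the variables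
`x l`, `l : Fin h`, and `y k`, `k : Fin r`, written as a sum of monomials. -/
noncomputable def walshForm {h r : ℕ} (φ : (Fin h → Bool) → Fin r → ℕ) : Form ℝ (h + r) :=
  ∑ c : Fin h → Bool, ∑ b : Fin h → Bool, walshSign c b •
    (ContinuousMultilinearMap.mkPiAlgebra ℝ (Fin (h + r)) ℝ).compContinuousLinearMap
      fun k => evalCLM ℝ (walshIndex φ c b k)

variable {h r : ℕ} (φ : (Fin h → Bool) → Fin r → ℕ)

lemma walshForm_apply (x : Fin (h + r) → C₀(ℕ, ℝ)) :
    walshForm φ x = ∑ c, ∑ b, walshSign c b * ∏ k, x k (walshIndex φ c b k) := by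
  simp [walshForm]

lemma walshForm_apply_eq_sum_prod (x : Fin (h + r) → C₀(ℕ, ℝ)) :
    walshForm φ x = ∑ c : Fin h → Bool, (∏ k, x (Fin.natAdd h k) (φ c k)) *
      ∏ l, (x (Fin.castAdd r l) 0 + (if c l then -1 else 1) * x (Fin.castAdd r l) 1) := by
  rw [walshForm_apply]
  refine Finset.sum_congr rfl fun c _ => ?_
  have h1 (l : Fin h) :
      x (Fin.castAdd r l) 0 + (if c l then -1 else 1) * x (Fin.castAdd r l) 1 =
      ∑ β : Bool, (if c l && β then (-1 : ℝ) else 1) * x (Fin.castAdd r l) β.toNat := by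
    simp [add_comm]
  simp only [h1]
  rw [Finset.prod_univ_sum, Fintype.piFinset_univ, Finset.mul_sum]
  refine Finset.sum_congr rfl fun b _ => ?_
  rw [Fin.prod_univ_add, Finset.prod_mul_distrib]
  simp only [walshIndex, walshSign, Fin.append_left, Fin.append_right]
  ring

/-- For real `a`, `b` one has `|a + b| + |a - b| = 2 max |a| |b|`, which keeps the norm small. -/
lemma norm_walshForm_le : ‖walshForm φ‖ ≤ 2 ^ h := by
  refine ContinuousMultilinearMap.opNorm_le_bound (by positivity) fun x => ?_
  have h1 (l : Fin h) : ∑ β : Bool, |x (Fin.castAdd r l) 0 +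
      (if β then -1 else 1) * x (Fin.castAdd r l) 1| ≤ 2 * ‖x (Fin.castAdd r l)‖ := by
    have h0 := abs_le.1 (norm_apply_le (x (Fin.castAdd r l)) 0)
    have h1 := abs_le.1 (norm_apply_le (x (Fin.castAdd r l)) 1)
    simp only [Fintype.sum_bool, if_true, Bool.false_eq_true, if_false]
    rcases abs_cases (x (Fin.castAdd r l) 0 + -1 * x (Fin.castAdd r l) 1) with h2 | h2 <;>
      rcases abs_cases (x (Fin.castAdd r l) 0 + 1 * x (Fin.castAdd r l) 1) with h3 | h3 <;>
      linarith
  calc ‖walshForm φ x‖ ≤ ∑ c : Fin h → Bool, (∏ k, ‖x (Fin.natAdd h k)‖) *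
        ∏ l, |x (Fin.castAdd r l) 0 + (if c l then -1 else 1) * x (Fin.castAdd r l) 1| := by
        rw [walshForm_apply_eq_sum_prod]
        refine norm_sum_le_of_le _ fun c _ => ?_
        rw [norm_mul, norm_prod, norm_prod]
        simp only [← Real.norm_eq_abs]
        gcongr with k _
        exact norm_apply_le _ _
    _ = (∏ k, ‖x (Fin.natAdd h k)‖) * ∏ l, ∑ β : Bool, |x (Fin.castAdd r l) 0 +
        (if β then -1 else 1) * x (Fin.castAdd r l) 1| := by
        rw [← Finset.mul_sum, Finset.prod_univ_sum, Fintype.piFinset_univ]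
    _ ≤ (∏ k, ‖x (Fin.natAdd h k)‖) * ∏ l, (2 * ‖x (Fin.castAdd r l)‖) := by
        gcongr with l _
        exact h1 l
    _ = 2 ^ h * ∏ k, ‖x k‖ := by
        rw [Fin.prod_univ_add, Finset.prod_mul_distrib]
        simp
        ring

variable {φ}

lemma toNat_injective : Function.Injective Bool.toNat := by decide

lemma walshIndex_injective (hφ : φ.Injective) :
    Function.Injective fun p : (Fin h → Bool) × (Fin h → Bool) => walshIndex φ p.1 p.2 := by
  rintro ⟨c, b⟩ ⟨c', b'⟩ hcb
  have hc : c = c' := hφ <| funext fun k => by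
    simpa [walshIndex] using congrFun hcb (Fin.natAdd h k)
  have hb : b = b' := funext fun l => by
    have := congrFun hcb (Fin.castAdd r l)
    simp only [walshIndex, Fin.append_left] at this
    exact toNat_injective this
  rw [hc, hb]

lemma enorm_walshForm_unitVec (hφ : φ.Injective) (c b : Fin h → Bool) :
    ‖walshForm φ fun k => unitVec ℝ (walshIndex φ c b k)‖ₑ = 1 := by
  have h1 (c' b') : ∏ k, unitVec ℝ (walshIndex φ c b k) (walshIndex φ c' b' k) =
      if (c', b') = (c, b) then 1 else 0 := by
    split_ifs with heq
    · obtain ⟨rfl, rfl⟩ := Prod.mk.inj heq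
      simp [unitVec_apply]
    · obtain ⟨k, hk⟩ := Function.ne_iff.1 ((walshIndex_injective hφ).ne heq)
      exact Finset.prod_eq_zero (Finset.mem_univ k) (by rw [unitVec_apply, if_neg hk])
  have h2 : walshForm φ (fun k => unitVec ℝ (walshIndex φ c b k)) = walshSign c b := by
    rw [walshForm_apply, ← Fintype.sum_prod_type'
      (f := fun c' b' => walshSign c' b' *
        ∏ k, unitVec ℝ (walshIndex φ c b k) (walshIndex φ c' b' k))]
    simp [h1]
  have h3 : ‖walshSign c b‖ = 1 := by
    rw [walshSign, norm_prod]
    refine Finset.prod_eq_one fun l _ => ?_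
    split_ifs <;> simp
  rw [h2, ← ofReal_norm, h3, ENNReal.ofReal_one]

/-- The form `walshForm φ` has `4 ^ h` coefficients of modulus one and norm at most `2 ^ h`. -/
lemma two_rpow_le_optimalConst {M : ℕ} (hφ : φ.Injective) (hr : 0 < r)
    (hM : ∀ c b, (Set.range (walshIndex φ c b)).ncard ≤ M) :
    (2 : ℝ≥0∞) ^ ((h : ℝ) / ((h + r : ℕ) : ℝ)) ≤ optimalConst ℝ (h + r) M := by
  refine le_sInf fun C hC => ?_
  set m := h + r with hm
  have hm0 : (0 : ℝ) < m := by exact_mod_cast (by omega : 0 < m)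
  have h1 : ((4 : ℝ≥0∞) ^ h) ^ (((m : ℝ) + 1) / (2 * m)) ≤ restrictedSum M (walshForm φ) := by
    rw [restrictedSum]
    refine ENNReal.rpow_le_rpow ?_ (by positivity)
    let ι : (Fin h → Bool) × (Fin h → Bool) → {i : Fin m → ℕ // (Set.range i).ncard ≤ M} :=
      fun p => ⟨walshIndex φ p.1 p.2, hM p.1 p.2⟩
    have hι : Function.Injective ι := fun p q hpq =>
      walshIndex_injective hφ (congrArg Subtype.val hpq)
    refine le_trans (le_of_eq ?_) (ENNReal.tsum_comp_le_tsum_of_injective hι _)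
    simp only [ι, enorm_walshForm_unitVec hφ, ENNReal.one_rpow, tsum_fintype, Finset.sum_const,
      Finset.card_univ, Fintype.card_prod, Fintype.card_pi, Fintype.card_bool, Finset.prod_const,
      Fintype.card_fin, nsmul_eq_mul, mul_one]
    push_cast
    rw [← mul_pow]
    norm_num
  have h2 : ‖walshForm φ‖ₑ ≤ 2 ^ h := by
    have : ENNReal.ofReal ‖walshForm φ‖ = ‖walshForm φ‖ₑ := ofReal_norm (walshForm φ)
    rw [← this]
    refine (ENNReal.ofReal_le_ofReal (norm_walshForm_le φ)).trans_eq ?_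
    rw [ENNReal.ofReal_pow (by norm_num)]
    norm_num
  have h3 : (2 : ℝ≥0∞) ^ ((h : ℝ) / (m : ℝ)) * 2 ^ h = (4 ^ h) ^ (((m : ℝ) + 1) / (2 * m)) := by
    rw [show (4 : ℝ≥0∞) = 2 ^ 2 by norm_num, ← pow_mul, ← ENNReal.rpow_natCast,
      ← ENNReal.rpow_natCast, ← ENNReal.rpow_mul,
      ← ENNReal.rpow_add_of_nonneg _ _ (by positivity) (by positivity)]
    congr 1
    push_cast
    field_simp
    ring
  have h4 : (2 : ℝ≥0∞) ^ ((h : ℝ) / (m : ℝ)) * 2 ^ h ≤ C * 2 ^ h := by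
    rw [h3]
    exact h1.trans ((hC _).trans (by gcongr))
  exact (ENNReal.mul_le_mul_iff_left (by positivity) (by simp)).1 h4

/-- With `r = 1` the last variable encodes all of `c` in a single index, so that only the three
entries `0`, `1` and the code of `c` occur. -/
lemma two_rpow_le_optimalConst_of_three_le {M m : ℕ} (hM : 3 ≤ M) (hm : 1 ≤ m) :
    (2 : ℝ≥0∞) ^ (1 - 1 / (m : ℝ)) ≤ optimalConst ℝ m M := by
  obtain ⟨h, rfl⟩ : ∃ h, m = h + 1 := ⟨m - 1, by omega⟩
  let φ : (Fin h → Bool) → Fin 1 → ℕ := fun c _ => Encodable.encode c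
  have hφ : φ.Injective := fun c c' hc => Encodable.encode_injective (congrFun hc 0)
  have h1 : (h : ℝ) / ((h + 1 : ℕ) : ℝ) = 1 - 1 / ((h + 1 : ℕ) : ℝ) := by
    push_cast
    field_simp
    ring
  rw [← h1]
  refine two_rpow_le_optimalConst hφ one_pos fun c b => le_trans ?_ hM
  have hsub : Set.range (walshIndex φ c b) ⊆ ({0, 1, Encodable.encode c} : Finset ℕ) := by
    rintro _ ⟨k, rfl⟩
    refine Fin.addCases (fun l => ?_) (fun l => ?_) k
    · cases hb : b l <;> simp [walshIndex, hb]
    · simp [walshIndex, φ]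
  refine (Set.ncard_le_ncard hsub (Finset.finite_toSet _)).trans ?_
  rw [Set.ncard_coe_finset]
  exact Finset.card_le_three

/-- With `h = m / 2` and `r ≥ h` the entries of `c` are distributed over `h` further variables,
and only the entries `0` and `1` occur. -/
lemma two_rpow_le_optimalConst_two {m : ℕ} (hm : 1 ≤ m) :
    (2 : ℝ≥0∞) ^ (1 / 2 - 1 / (m : ℝ)) ≤ optimalConst ℝ m 2 := by
  obtain ⟨h, r, hr, hrh, hhr, rfl⟩ : ∃ h r, 0 < r ∧ h ≤ r ∧ r ≤ h + 1 ∧ m = h + r :=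
    ⟨m / 2, m - m / 2, by omega, by omega, by omega, by omega⟩
  let φ : (Fin h → Bool) → Fin r → ℕ := fun c k =>
    if hk : (k : ℕ) < h then (c ⟨k, hk⟩).toNat else 0
  have hφ : φ.Injective := fun c c' hc => funext fun l => by
    have := congrFun hc (Fin.castLE hrh l)
    simpa [φ, toNat_injective.eq_iff] using this
  have h1 : 1 / 2 - 1 / ((h + r : ℕ) : ℝ) ≤ (h : ℝ) / ((h + r : ℕ) : ℝ) := by
    have h2 : (0 : ℝ) < ((h + r : ℕ) : ℝ) := by exact_mod_cast hm
    have h3 : (r : ℝ) ≤ h + 1 := by exact_mod_cast hhr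
    rw [sub_le_iff_le_add, ← add_div, le_div_iff₀ h2]
    push_cast
    linarith
  refine (ENNReal.rpow_le_rpow_of_exponent_le (by norm_num) h1).trans ?_
  refine two_rpow_le_optimalConst hφ hr fun c b => ?_
  have hsub : Set.range (walshIndex φ c b) ⊆ ({0, 1} : Finset ℕ) := by
    rintro _ ⟨k, rfl⟩
    refine Fin.addCases (fun l => ?_) (fun l => ?_) k
    · cases hb : b l <;> simp [walshIndex, hb]
    · by_cases hl : (l : ℕ) < h
      · cases hb : c ⟨l, hl⟩ <;> simp [walshIndex, φ, hl, hb]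
      · simp [walshIndex, φ, hl]
  refine (Set.ncard_le_ncard hsub (Finset.finite_toSet _)).trans ?_
  rw [Set.ncard_coe_finset]
  exact Finset.card_le_two

end Extremal

/-! ### Behaviour of the optimal constant for large `m` -/

section Limits

lemma tendsto_two_rpow (x : ℝ) :
    Tendsto (fun m : ℕ => (2 : ℝ≥0∞) ^ (x - 1 / (m : ℝ))) atTop (𝓝 (2 ^ x)) := by
  have h1 : Tendsto (fun m : ℕ => x - 1 / (m : ℝ)) atTop (𝓝 x) := by
    simpa using tendsto_const_nhds.sub (tendsto_one_div_atTop_nhds_zero_nat (𝕜 := ℝ))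
  have h2 (y : ℝ) : (2 : ℝ≥0∞) ^ y = ENNReal.ofReal (2 ^ y) := by
    rw [← ENNReal.ofReal_rpow_of_pos (by norm_num)]
    norm_num
  simp only [h2]
  exact ENNReal.tendsto_ofReal (((Real.continuous_const_rpow (by norm_num)).tendsto x).comp h1)

lemma natCast_rpow_eq_ofReal (M : ℕ) {y : ℝ} (hy : 0 ≤ y) :
    (M : ℝ≥0∞) ^ y = ENNReal.ofReal ((M : ℝ) ^ y) := by
  rw [← ENNReal.ofReal_rpow_of_nonneg (by positivity) hy, ENNReal.ofReal_natCast]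

lemma limsup_optimalConst_le {M : ℕ} (hM : 1 ≤ M) :
    limsup (fun m : ℕ => optimalConst ℝ m M) atTop ≤
      ENNReal.ofReal ((M : ℝ) ^ (((M : ℝ) + 1) / 2)) := by
  set D : ℝ := (M : ℝ) ^ (((M : ℝ) + 1) / 2)
  have h1 : Tendsto (fun m : ℕ => ENNReal.ofReal (D * (2 ^ (M + 1) : ℝ) ^ ((M : ℝ) / m))) atTop
      (𝓝 (ENNReal.ofReal D)) := by
    refine ENNReal.tendsto_ofReal ?_
    have h2 : Tendsto (fun m : ℕ => (2 ^ (M + 1) : ℝ) ^ ((M : ℝ) / m)) atTop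
        (𝓝 ((2 ^ (M + 1) : ℝ) ^ (0 : ℝ))) :=
      ((Real.continuous_const_rpow (by positivity)).tendsto 0).comp
        (tendsto_const_div_atTop_nhds_zero_nat (M : ℝ))
    simpa using h2.const_mul D
  rw [← h1.limsup_eq]
  refine limsup_le_limsup ?_
  filter_upwards [eventually_ge_atTop M] with m hm
  refine sInf_le fun T => (restrictedSum_le hM hm T).trans_eq ?_
  rw [ENNReal.ofReal_mul (by positivity), ← natCast_rpow_eq_ofReal M (by positivity),
    ← ENNReal.ofReal_rpow_of_nonneg (by positivity) (by positivity),
    ENNReal.ofReal_pow (by norm_num)]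
  norm_num

end Limits

end BohnenblustHille

open BohnenblustHille in
theorem theorem2p2 (M : ℕ) (hM : 1 ≤ M) :
    (∃ η : ℝ, 1 ≤ η ∧ ∀ m : ℕ, M ≤ m →
      (∀ T : BohnenblustHille.Form ℝ m,
        BohnenblustHille.restrictedSum M T ≤ ENNReal.ofReal η * ‖T‖ₑ) ∧
      (∀ T : BohnenblustHille.Form ℂ m,
        BohnenblustHille.restrictedSum M T ≤ ENNReal.ofReal η * ‖T‖ₑ)) ∧
    (3 ≤ M →
      2 ≤ liminf (fun m : ℕ => BohnenblustHille.optimalConst ℝ m M) atTop ∧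
      liminf (fun m : ℕ => BohnenblustHille.optimalConst ℝ m M) atTop ≤
        limsup (fun m : ℕ => BohnenblustHille.optimalConst ℝ m M) atTop ∧
      limsup (fun m : ℕ => BohnenblustHille.optimalConst ℝ m M) atTop ≤
        ENNReal.ofReal ((M : ℝ) ^ (((M : ℝ) + 1) / 2))) ∧
    (M = 2 →
      ENNReal.ofReal (Real.sqrt 2) ≤
        liminf (fun m : ℕ => BohnenblustHille.optimalConst ℝ m M) atTop ∧
      liminf (fun m : ℕ => BohnenblustHille.optimalConst ℝ m M) atTop ≤
        limsup (fun m : ℕ => BohnenblustHille.optimalConst ℝ m M) atTop ∧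
      limsup (fun m : ℕ => BohnenblustHille.optimalConst ℝ m M) atTop ≤
        ENNReal.ofReal (Real.sqrt 8)) := by
  refine ⟨?_, fun hM3 => ⟨?_, liminf_le_limsup, limsup_optimalConst_le hM⟩, ?_⟩
  · have hM' : (1 : ℝ) ≤ M := by exact_mod_cast hM
    refine ⟨(M : ℝ) ^ (((M : ℝ) + 1) / 2) * 2 ^ (M + 1), ?_, fun m hm => ?_⟩
    · exact one_le_mul_of_one_le_of_one_le (Real.one_le_rpow hM' (by positivity))
        (one_le_pow₀ (by norm_num))
    · have key : (M : ℝ≥0∞) ^ (((M : ℝ) + 1) / 2) * (2 ^ (M + 1)) ^ ((M : ℝ) / m) ≤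
          ENNReal.ofReal ((M : ℝ) ^ (((M : ℝ) + 1) / 2) * 2 ^ (M + 1)) := by
        rw [ENNReal.ofReal_mul (by positivity), ← natCast_rpow_eq_ofReal M (by positivity),
          ENNReal.ofReal_pow (by norm_num), ENNReal.ofReal_ofNat]
        gcongr
        have hexp : (M : ℝ) / m ≤ 1 := by
          have hm0 : (0 : ℝ) < m := by exact_mod_cast hM.trans hm
          rw [div_le_one hm0]
          exact_mod_cast hm
        refine (ENNReal.rpow_le_rpow_of_exponent_le (one_le_pow₀ (by norm_num)) hexp).trans_eq ?_
        rw [ENNReal.rpow_one]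
      exact ⟨fun T => (restrictedSum_le hM hm T).trans (by gcongr),
        fun T => (restrictedSum_le hM hm T).trans (by gcongr)⟩
  · have h1 := tendsto_two_rpow 1
    rw [ENNReal.rpow_one] at h1
    rw [← h1.liminf_eq]
    refine liminf_le_liminf ?_
    filter_upwards [eventually_ge_atTop 1] with m hm
    exact two_rpow_le_optimalConst_of_three_le hM3 hm
  · rintro rfl
    refine ⟨?_, liminf_le_limsup, (limsup_optimalConst_le hM).trans_eq ?_⟩
    · have h1 := tendsto_two_rpow (1 / 2)
      have h2 : ENNReal.ofReal √2 = 2 ^ (1 / 2 : ℝ) := by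
        rw [Real.sqrt_eq_rpow, ← ENNReal.ofReal_rpow_of_pos (by norm_num), ENNReal.ofReal_ofNat]
      rw [h2, ← h1.liminf_eq]
      refine liminf_le_liminf ?_
      filter_upwards [eventually_ge_atTop 1] with m hm
      exact two_rpow_le_optimalConst_two hm
    · rw [show (8 : ℝ) = 2 ^ (3 : ℝ) by norm_num, Real.sqrt_eq_rpow, ← Real.rpow_mul (by norm_num)]
      norm_num
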